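/- Let $N\ge 1$ be a fixed integer. For a real number $z$ let $P=P(z)$ be the product of all primes $p\le z$. Put $P_n=P/\gcd(P,n)$. Let $W_P(N)$ be the set of integers $1\le n\le P$ such that $(N-n)(N+n)$ is coprime to $P$, and let $W_P^1(N)$ be the set of those $n\in W_P(N)$ with $\gcd(P_{6N},n)=1$. Define the densities $\omega_P(N)=|W_P(N)|/P$ and $\omega_P^1(N)=|W_P^1(N)|/P$. Let $\gamma$ be the Euler–Mascheroni constant, $C_1=e^{\gamma}$, and, with $p$ always denoting a prime, $$C_2=\prod_{p\ge 3}\frac{(p-2)p}{(p-1)^2},\qquad d_N=\prod_{p\mid N,\ p\ge 3}\frac{p-1}{p-2},$$ $$C_3=\prod_{p\ge 5}\frac{(p-3)p^2}{(p-1)^3},\qquad d'_N=\varepsilon_N\prod_{p\mid N,\ p\ge 5}\frac{p-1}{p-3},$$ where $\varepsilon_N=2$ if $3\mid N$ and $\varepsilon_N=1$ otherwise. The infinite products $C_2$ and $C_3$ converge to positive limits, and the following hold. (1) For every real $z\ge 2$, $$\omega_P(N)=2\prod_{3\le p\le z}\frac{(p-2)p}{(p-1)^2}\ \prod_{p\mid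 N,\ 3\le p\le z}\frac{p-1}{p-2}\ \prod_{2\le p\le z}\Bigl(1-\frac1p\Bigr)^2,$$ and, as $z\to\infty$, $$\omega_P(N)\sim\frac{2C_2d_N}{C_1^2\log^2 z}.$$ (2) For every real $z\ge 3$, $$\omega_P^1(N)=\frac92\prod_{5\le p\le z}\frac{(p-3)p^2}{(p-1)^3}\cdot\varepsilon_N\prod_{p\mid N,\ 5\le p\le z}\frac{p-1}{p-3}\ \prod_{2\le p\le z}\Bigl(1-\frac1p\Bigr)^3,$$ and, as $z\to\infty$, $$\omega_P^1(N)\sim\frac{9C_3d'_N}{2C_1^3\log^3 z}.$$ -/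

import Mathlib

open scoped Asymptotics

noncomputable section

namespace GoldbachDensity

/-- `P_n = P / gcd(P, n)`. -/
def cofactor (P n : ℕ) : ℕ := P / Nat.gcd P n

/-- `W_P(N)`: the integers `1 ≤ n ≤ P` such that `(N - n)(N + n)` is coprime to `P`.
The product is taken in `ℤ`. -/
def W (P N : ℕ) : Finset ℕ :=
  (Finset.Icc 1 P).filter fun n => Int.gcd (((N : ℤ) - n) * ((N : ℤ) + n)) (P : ℤ) = 1

/-- `W_P^d(N)`: the `n ∈ W_P(N)` such that `gcd(P_{6N}, n) = d`. -/
def Wd (d P N : ℕ) : Finset ℕ :=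
  (W P N).filter fun n => Nat.gcd (cofactor P (6 * N)) n = d

/-- The density `ω_P(N) = |W_P(N)| / P`. -/
def omega (P N : ℕ) : ℝ := ((W P N).card : ℝ) / P

/-- The density `ω_P^d(N) = |W_P^d(N)| / P`. -/
def omegaD (d P N : ℕ) : ℝ := ((Wd d P N).card : ℝ) / P

/-- The product of all primes `p ≤ z`. -/
def primeProd (z : ℝ) : ℕ := primorial ⌊z⌋₊

/-- The primes `p` with `a ≤ p ≤ z`. -/
def primesIn (a : ℕ) (z : ℝ) : Finset ℕ := (Finset.Icc a ⌊z⌋₊).filter Nat.Prime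

/-- The factor `(p - 2) p / (p - 1)²`. -/
def factor2 (p : ℕ) : ℝ := ((p : ℝ) - 2) * p / ((p : ℝ) - 1) ^ 2

/-- The factor `(p - 3) p² / (p - 1)³`. -/
def factor3 (p : ℕ) : ℝ := ((p : ℝ) - 3) * (p : ℝ) ^ 2 / ((p : ℝ) - 1) ^ 3

/-- `C_1 = e^γ`. -/
def C₁ : ℝ := Real.exp Real.eulerMascheroniConstant

/-- The twin prime constant, the infinite product of `factor2` over all primes `p ≥ 3`. -/
def C₂ : ℝ := ∏' p : {p : ℕ // p.Prime ∧ 3 ≤ p}, factor2 p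

/-- The infinite product of `factor3` over all primes `p ≥ 5`. -/
def C₃ : ℝ := ∏' p : {p : ℕ // p.Prime ∧ 5 ≤ p}, factor3 p

/-- `d_N`, the product of `(p - 1) / (p - 2)` over the primes `p ≥ 3` dividing `N`. -/
def dN (N : ℕ) : ℝ :=
  ∏ p ∈ N.primeFactors.filter (fun p => 3 ≤ p), ((p : ℝ) - 1) / ((p : ℝ) - 2)

/-- The factor `2` if `3 ∣ N`, and the empty product otherwise. -/
def threeFactor (N : ℕ) : ℝ := if 3 ∣ N then 2 else 1

/-- `d'_N`, the product of `(p - 1) / (p - 3)` over the primes `p ≥ 5` dividing `N`, with an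
extra factor `2` if `3 ∣ N`. -/
def dN' (N : ℕ) : ℝ :=
  threeFactor N *
    ∏ p ∈ N.primeFactors.filter (fun p => 5 ≤ p), ((p : ℝ) - 1) / ((p : ℝ) - 3)

end GoldbachDensity

end

/-!
By the Chinese remainder theorem `ω_P(N)` is the product over the primes `p ∣ P` of the local
densities `1 - |F_p| / p`, where `F_p = {N, -N} ⊆ ZMod p` is the set of excluded residues; for
`ω_P^1(N)` the class `0` is excluded as well when `p ∤ 6N`. Dividing each local density by the
square (respectively the cube) of `1 - 1/p` leaves factors `1 + O(1/p²)`, whose product converges,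
and the remaining power of `∏ (1 - 1/p)` is governed by Mertens' third theorem.

For this, comparing `log n!` with its prime factorization gives
`∑_{p ≤ n} log p / p = log n + O(1)`, and summation by parts gives
`∑_{p ≤ n} 1/p = log log n + c + o(1)` for some `c`. To find `c`, compare the Dirichlet series
`∑ p^{-1-s}` and `∑ e^{-sn} / n = -log (1 - e^{-s})`: the partial sums `∑_{log p ≤ u} 1/p` and
`∑_{n ≤ u} 1/n` differ by `c - γ + o(1)` as `u → ∞`, so by Abel's theorem the two series differ by
`c - γ + o(1)` as `s → 0⁺`. As `s ζ(1 + s) → 1`, the Euler product of `ζ` shows that this difference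
also tends to `-∑_p (-log (1 - 1/p) - 1/p)`.
-/

namespace GoldbachDensity

section LogTail

open Filter Topology Real

/-- The tail `∑_{k ≥ 2} x ^ k / k` of the Taylor series of `-log (1 - x)`: what the sum over primes
of `x = p⁻ˢ` misses of the logarithm of the Euler product. -/
noncomputable def logTail (x : ℝ) : ℝ := -log (1 - x) - x

lemma abs_logTail_le {x : ℝ} (hx : |x| ≤ 1 / 2) : |logTail x| ≤ 2 * x ^ 2 := by
  have h := abs_log_sub_add_sum_range_le (hx.trans_lt one_half_lt_one) 1
  calc |logTail x| = |x + log (1 - x)| := by rw [logTail, ← abs_neg]; ring_nf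
    _ ≤ |x| ^ 2 / (1 - |x|) := by simpa using h
    _ ≤ |x| ^ 2 / (1 / 2) := by gcongr; linarith
    _ = 2 * x ^ 2 := by rw [sq_abs]; ring

lemma continuousAt_logTail {x : ℝ} (hx : x < 1) : ContinuousAt logTail x := by
  unfold logTail
  have : 1 - x ≠ 0 := by linarith
  fun_prop (disch := assumption)

lemma summable_logTail {ι : Type*} {x : ι → ℝ} (hx : Summable fun i => x i ^ 2) :
    Summable fun i => logTail (x i) := by
  have h : Tendsto (fun i => |x i|) cofinite (𝓝 0) := by
    simpa [sqrt_sq_eq_abs] using hx.tendsto_cofinite_zero.sqrt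
  refine .of_norm_bounded_eventually (hx.mul_left 2) ?_
  filter_upwards [h.eventually_le_const one_half_pos] with i hi using abs_logTail_le hi

end LogTail

section PrimeSums

open Finset Filter Topology Real

lemma log_factorial_eq_sum_primesLE (n : ℕ) :
    log (n.factorial : ℝ) = ∑ p ∈ Nat.primesLE n, (n.factorial.factorization p : ℝ) * log p := by
  rw [log_nat_eq_sum_factorization, Finsupp.sum_of_support_subset (s := Nat.primesLE n)]
  · intro p hp
    rw [Nat.support_factorization, Nat.mem_primeFactors] at hp
    exact Nat.mem_primesLE.2 ⟨hp.1.dvd_factorial.1 hp.2.1, hp.1⟩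
  · simp

lemma div_sub_one_le_factorization_factorial (n : ℕ) {p : ℕ} (hp : p.Prime) :
    (n : ℝ) / p - 1 ≤ n.factorial.factorization p := by
  have h : n / p ≤ n.factorial.factorization p := by
    rw [Nat.factorization_factorial hp (b := Nat.log p n + 2) (by lia)]
    simpa using single_le_sum (f := fun i => n / p ^ i) (fun _ _ => Nat.zero_le _)
      (mem_Ico.2 ⟨le_rfl, by lia⟩ : 1 ∈ Ico 1 (Nat.log p n + 2))
  have h' : ((n / p : ℕ) : ℝ) ≤ n.factorial.factorization p := by exact_mod_cast h
  rw [← Nat.floor_div_eq_div (K := ℝ)] at h'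
  linarith [Nat.lt_floor_add_one ((n : ℝ) / p)]

lemma factorization_factorial_le_div_sub_one (n : ℕ) {p : ℕ} (hp : p.Prime) :
    (n.factorial.factorization p : ℝ) ≤ n / ((p : ℝ) - 1) := by
  calc (n.factorial.factorization p : ℝ) ≤ (n / (p - 1) : ℕ) := by
        exact_mod_cast Nat.factorization_factorial_le_div_pred hp n
    _ ≤ n / ((p - 1 : ℕ) : ℝ) := Nat.cast_div_le
    _ = n / ((p : ℝ) - 1) := by rw [Nat.cast_pred hp.pos]

lemma sum_log_div_primesLE_le (n : ℕ) :
    ∑ p ∈ Nat.primesLE n, log p / p ≤ log n + log 4 := by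
  rcases n.eq_zero_or_pos with rfl | hn
  · simpa using log_nonneg (by norm_num)
  have hn' : (0 : ℝ) < n := by exact_mod_cast hn
  refine le_of_mul_le_mul_left ?_ hn'
  have hθ := Chebyshev.theta_le_log4_mul_x (x := n) hn'.le
  rw [Chebyshev.theta_eq_sum_primesLE_log] at hθ
  have hfac : log (n.factorial : ℝ) ≤ n * log n := by
    rw [← log_pow]
    exact log_le_log (by exact_mod_cast n.factorial_pos) (by exact_mod_cast n.factorial_le_pow)
  calc n * ∑ p ∈ Nat.primesLE n, log p / p
      = ∑ p ∈ Nat.primesLE n, ((n : ℝ) / p - 1) * log p + ∑ p ∈ Nat.primesLE n, log p := by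
        rw [mul_sum, ← sum_add_distrib]
        exact sum_congr rfl fun p _ => by ring
    _ ≤ log (n.factorial : ℝ) + log 4 * n := by
        rw [log_factorial_eq_sum_primesLE]
        gcongr with p hp
        exact div_sub_one_le_factorization_factorial n (Nat.prime_of_mem_primesLE hp)
    _ ≤ n * (log n + log 4) := by linarith

lemma log_sub_one_le_sum_log_div_primesLE (n : ℕ) :
    log n - 1 ≤ ∑ p ∈ Nat.primesLE n, log p / ((p : ℝ) - 1) := by
  rcases n.eq_zero_or_pos with rfl | hn
  · simp
  have hn' : (0 : ℝ) < n := by exact_mod_cast hn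
  refine le_of_mul_le_mul_left ?_ hn'
  calc n * (log n - 1) ≤ log (n.factorial : ℝ) := by
        have h := Stirling.le_log_factorial_stirling hn.ne'
        have := log_natCast_nonneg n
        have : 0 ≤ log (2 * π) := log_nonneg (by linarith [pi_gt_three])
        linarith
    _ = ∑ p ∈ Nat.primesLE n, (n.factorial.factorization p : ℝ) * log p :=
        log_factorial_eq_sum_primesLE n
    _ ≤ ∑ p ∈ Nat.primesLE n, n / ((p : ℝ) - 1) * log p := by
        gcongr with p hp
        exact factorization_factorial_le_div_sub_one n (Nat.prime_of_mem_primesLE hp)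
    _ = n * ∑ p ∈ Nat.primesLE n, log p / ((p : ℝ) - 1) := by
        rw [mul_sum]
        exact sum_congr rfl fun p _ => by ring

lemma summable_log_div_mul_sub_one : Summable fun n : ℕ => log n / (n * ((n : ℝ) - 1)) := by
  refine .of_norm_bounded_eventually_nat (g := fun n : ℕ => 4 * (n : ℝ) ^ (-(3 / 2) : ℝ))
    ((Real.summable_nat_rpow.2 (by norm_num)).mul_left 4) ?_
  filter_upwards [eventually_ge_atTop 2] with n hn
  have hn' : (2 : ℝ) ≤ n := by exact_mod_cast hn
  rw [norm_of_nonneg (div_nonneg (log_natCast_nonneg n) (by nlinarith))]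
  calc log n / (n * ((n : ℝ) - 1))
      ≤ ((n : ℝ) ^ (1 / 2 : ℝ) / (1 / 2)) / ((n : ℝ) ^ (2 : ℝ) / 2) := by
        gcongr
        · exact log_le_rpow_div (by positivity) (by norm_num)
        · rw [rpow_two]; nlinarith
    _ = 4 * ((n : ℝ) ^ (1 / 2 : ℝ) / (n : ℝ) ^ (2 : ℝ)) := by ring
    _ = 4 * (n : ℝ) ^ (-(3 / 2) : ℝ) := by rw [← rpow_sub (by positivity)]; norm_num

lemma exists_abs_sum_log_div_primesLE_sub_log_le :
    ∃ C : ℝ, ∀ n : ℕ, |∑ p ∈ Nat.primesLE n, log p / p - log n| ≤ C := by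
  refine ⟨log 4 + 1 + ∑' k : ℕ, log k / (k * ((k : ℝ) - 1)), fun n => ?_⟩
  have hnonneg (k : ℕ) : 0 ≤ log k / (k * ((k : ℝ) - 1)) := by
    rcases k.eq_zero_or_pos with rfl | hk
    · simp
    have : (1 : ℝ) ≤ k := by exact_mod_cast hk
    exact div_nonneg (log_natCast_nonneg k) (mul_nonneg (by linarith) (by linarith))
  have hdiff : ∑ p ∈ Nat.primesLE n, log p / ((p : ℝ) - 1) - ∑ p ∈ Nat.primesLE n, log p / p ≤
      ∑' k : ℕ, log k / (k * ((k : ℝ) - 1)) := by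
    rw [← sum_sub_distrib]
    refine le_of_eq_of_le (sum_congr rfl fun p hp => ?_)
      (summable_log_div_mul_sub_one.sum_le_tsum (Nat.primesLE n) fun k _ => hnonneg k)
    have hp1 : (1 : ℝ) < p := by exact_mod_cast (Nat.prime_of_mem_primesLE hp).one_lt
    have : (p : ℝ) - 1 ≠ 0 := by linarith
    field_simp
    ring
  have hlower := log_sub_one_le_sum_log_div_primesLE n
  have hupper := sum_log_div_primesLE_le n
  have hlog4 : 0 ≤ log 4 := log_nonneg (by norm_num)
  rw [abs_le]
  constructor <;> linarith [tsum_nonneg (L := .unconditional ℕ) hnonneg]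

lemma exists_tendsto_sum_one_sub_div_sub_log {u : ℕ → ℝ} (hu : ∀ i, 0 < u i)
    (hsq : Summable fun i => (1 - u i / u (i + 1)) ^ 2) :
    ∃ c, Tendsto (fun n => ∑ i ∈ range n, (1 - u i / u (i + 1)) - log (u n)) atTop (𝓝 c) := by
  refine ⟨-log (u 0) - ∑' i, logTail (1 - u i / u (i + 1)),
    ((summable_logTail hsq).hasSum.tendsto_sum_nat.const_sub _).congr fun n => ?_⟩
  have htelescope := sum_range_sub (fun i => log (u i)) n
  have hterm (i : ℕ) : 1 - u i / u (i + 1) =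
      log (u (i + 1)) - log (u i) - logTail (1 - u i / u (i + 1)) := by
    rw [logTail, sub_sub_cancel, log_div (hu i).ne' (hu (i + 1)).ne']
    ring
  rw [sum_congr rfl fun i _ => hterm i, sum_sub_distrib, htelescope]
  ring

lemma exists_tendsto_sum_div_sub_log {a u : ℕ → ℝ} (hu : ∀ i, 0 < u i) (hmono : Monotone u)
    (htop : Tendsto u atTop atTop) (hsq : Summable fun i => (1 - u i / u (i + 1)) ^ 2)
    {C : ℝ} (hC : ∀ n, |∑ i ∈ range n, a i - u n| ≤ C) :
    ∃ c, Tendsto (fun n => ∑ i ∈ range n, a i / u (i + 1) - log (u n)) atTop (𝓝 c) := by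
  have hanti : Antitone fun i => (u (i + 1))⁻¹ := fun i j hij =>
    inv_anti₀ (hu _) (hmono (by lia))
  have hzero : Tendsto (fun i => (u (i + 1))⁻¹) atTop (𝓝 0) :=
    (htop.comp (tendsto_add_atTop_nat 1)).inv_tendsto_atTop
  -- Dirichlet's test: `a i - (u (i + 1) - u i)` has bounded partial sums.
  have hbounded (n : ℕ) : ‖∑ i ∈ range n, (a i - (u (i + 1) - u i))‖ ≤ C + u 0 := by
    rw [sum_sub_distrib, sum_range_sub, norm_eq_abs, ← sub_add]
    exact (abs_add_le _ _).trans (add_le_add (hC n) (abs_of_pos (hu 0)).le)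
  obtain ⟨b, hb⟩ := cauchySeq_tendsto_of_complete
    (hanti.cauchySeq_series_mul_of_tendsto_zero_of_bounded hzero hbounded)
  obtain ⟨c, hc⟩ := exists_tendsto_sum_one_sub_div_sub_log hu hsq
  refine ⟨b + c, (hb.add hc).congr fun n => ?_⟩
  rw [← add_sub_assoc, ← sum_add_distrib]
  congr! 2 with i
  have := (hu (i + 1)).ne'
  simp only [smul_eq_mul]
  field_simp
  ring

lemma summable_sq_one_sub_log_div_log :
    Summable fun i : ℕ => (1 - log ((i + 2 : ℕ) : ℝ) / log ((i + 1 + 2 : ℕ) : ℝ)) ^ 2 := by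
  refine .of_nonneg_of_le (fun i => sq_nonneg _) (fun i => ?_)
    ((summable_nat_add_iff 2).2 (Real.summable_one_div_nat_pow.2 one_lt_two))
  push_cast
  have hpos : 0 < (i : ℝ) + 2 := by positivity
  have hlog1 : 1 ≤ log ((i : ℝ) + 1 + 2) := by
    rw [le_log_iff_exp_le (by positivity)]
    linarith [exp_one_lt_three, (Nat.cast_nonneg i : (0 : ℝ) ≤ i)]
  have hle : log ((i : ℝ) + 2) ≤ log ((i : ℝ) + 1 + 2) := log_le_log hpos (by linarith)
  have hratio : log ((i : ℝ) + 2) / log ((i : ℝ) + 1 + 2) ≤ 1 :=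
    div_le_one_of_le₀ hle (by linarith)
  have hstep : log ((i : ℝ) + 1 + 2) - log ((i : ℝ) + 2) ≤ 1 / ((i : ℝ) + 2) := by
    rw [← log_div (by positivity) hpos.ne']
    refine (log_le_sub_one_of_pos (by positivity)).trans_eq ?_
    field_simp
    ring
  rw [← one_div_pow]
  refine pow_le_pow_left₀ (by linarith) ?_ 2
  calc 1 - log ((i : ℝ) + 2) / log ((i : ℝ) + 1 + 2)
      = (log ((i : ℝ) + 1 + 2) - log ((i : ℝ) + 2)) / log ((i : ℝ) + 1 + 2) := by
        field_simp
    _ ≤ log ((i : ℝ) + 1 + 2) - log ((i : ℝ) + 2) := div_le_self (by linarith) hlog1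
    _ ≤ 1 / ((i : ℝ) + 2) := hstep

lemma sum_primesLE_add_two {M : Type*} [AddCommMonoid M] (f : ℕ → M) (n : ℕ) :
    ∑ p ∈ Nat.primesLE (n + 2), f p =
      ∑ i ∈ range n, (if (i + 3).Prime then f (i + 3) else 0) + f 2 := by
  rw [Nat.primesLE_eq_filter_range, sum_filter, sum_range_succ', sum_range_succ', sum_range_succ']
  simp [Nat.not_prime_zero, Nat.not_prime_one, Nat.prime_two]

lemma exists_tendsto_sum_one_div_primesLE_sub_log_log : ∃ c : ℝ, Tendsto (fun n : ℕ =>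
    ∑ p ∈ Nat.primesLE n, 1 / (p : ℝ) - log (log n)) atTop (𝓝 c) := by
  obtain ⟨C, hC⟩ := exists_abs_sum_log_div_primesLE_sub_log_le
  have hbounded (n : ℕ) : |∑ i ∈ range n, (if (i + 3).Prime then
      log ((i + 3 : ℕ) : ℝ) / (i + 3 : ℕ) else 0) - log ((n + 2 : ℕ) : ℝ)| ≤ C + log 2 / 2 := by
    have h := hC (n + 2)
    rw [sum_primesLE_add_two fun p => log p / p, abs_le] at h
    have : 0 ≤ log 2 / 2 := by positivity
    push_cast at h ⊢
    rw [abs_le]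
    constructor <;> linarith
  have hmono : Monotone fun i : ℕ => log ((i + 2 : ℕ) : ℝ) := fun i j hij =>
    log_le_log (by positivity) (by exact_mod_cast Nat.add_le_add_right hij 2)
  obtain ⟨c, hc⟩ := exists_tendsto_sum_div_sub_log (fun i => log_pos (by norm_cast; lia)) hmono
    (tendsto_log_atTop.comp (tendsto_natCast_atTop_atTop.comp (tendsto_add_atTop_nat 2)))
    summable_sq_one_sub_log_div_log hbounded
  refine ⟨c + 1 / 2, (tendsto_add_atTop_iff_nat 2).1 ((hc.add_const (1 / 2)).congr fun n => ?_)⟩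
  rw [sum_primesLE_add_two fun p => 1 / (p : ℝ)]
  have hterm (i : ℕ) : (if (i + 3).Prime then log ((i + 3 : ℕ) : ℝ) / (i + 3 : ℕ) else 0) /
      log ((i + 3 : ℕ) : ℝ) = if (i + 3).Prime then 1 / ((i + 3 : ℕ) : ℝ) else 0 := by
    have : log ((i + 3 : ℕ) : ℝ) ≠ 0 := (log_pos (by norm_cast; lia)).ne'
    split_ifs
    · field_simp
    · rw [zero_div]
  rw [← sum_congr rfl fun i _ => hterm i]
  push_cast
  ring_nf

end PrimeSums

section AbelSummation

open Filter Topology Real MeasureTheory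

variable {ι : Type*} {a l : ι → ℝ} {S : ℝ → Finset ι}

lemma measurable_finset_of_mem_iff_le [Countable ι] (hS : ∀ i u, i ∈ S u ↔ l i ≤ u) :
    @Measurable ℝ (Finset ι) _ ⊤ S := by
  let _ : MeasurableSpace (Finset ι) := ⊤
  have hmono : Monotone S := fun u v huv i hi => (hS i v).2 (((hS i u).1 hi).trans huv)
  refine measurable_to_countable' fun T => Set.OrdConnected.measurableSet ⟨?_⟩
  rintro u rfl v hv t ht
  exact le_antisymm ((hmono ht.2).trans_eq hv) (hmono ht.1)

lemma tsum_mul_exp_neg_eq_integral [Countable ι] (hl : ∀ i, 0 ≤ l i)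
    (hS : ∀ i u, i ∈ S u ↔ l i ≤ u) {s : ℝ} (hs : 0 < s)
    (ha : Summable fun i => a i * exp (-(s * l i))) :
    ∑' i, a i * exp (-(s * l i)) = ∫ t in Set.Ioi 0, exp (-t) * ∑ i ∈ S (t / s), a i := by
  let jump (b : ℝ) (i : ι) : ℝ → ℝ := (Set.Ici (s * l i)).indicator fun t => b * exp (-t)
  have hintegral (b : ℝ) (i : ι) : ∫ t in Set.Ici 0, jump b i t = b * exp (-(s * l i)) := by
    rw [setIntegral_indicator measurableSet_Ici, Set.Ici_inter_Ici,
      sup_eq_right.2 (mul_nonneg hs.le (hl i)), integral_Ici_eq_integral_Ioi, integral_const_mul,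
      integral_exp_neg_Ioi]
  have hintegrable (i : ι) : Integrable (jump (a i) i) (volume.restrict (Set.Ici 0)) :=
    (((integrableOn_Ici_iff_integrableOn_Ioi (by simp)).2
      (integrableOn_exp_neg_Ioi 0)).integrable.const_mul (a i)).indicator measurableSet_Ici
  have hnorm (i : ι) : ∫ t in Set.Ici 0, ‖jump (a i) i t‖ = ‖a i * exp (-(s * l i))‖ := by
    rw [norm_mul, norm_of_nonneg (exp_pos _).le, ← hintegral ‖a i‖ i]
    congr 1 with t
    simp only [jump, norm_indicator_eq_indicator_norm, norm_mul, norm_of_nonneg (exp_pos _).le]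
  have hmem (i : ι) (t : ℝ) : i ∈ S (t / s) ↔ t ∈ Set.Ici (s * l i) := by
    rw [hS, le_div_iff₀' hs, Set.mem_Ici]
  have hsum := (hasSum_integral_of_summable_integral_norm hintegrable
    (by simpa only [hnorm] using ha.norm)).tsum_eq
  simp only [hintegral] at hsum
  rw [hsum, integral_Ici_eq_integral_Ioi]
  congr 1 with t
  rw [tsum_eq_sum (s := S (t / s)) fun i hi => Set.indicator_of_notMem (mt (hmem i t).2 hi) _,
    Finset.mul_sum]
  exact Finset.sum_congr rfl fun i hi => by
    rw [Set.indicator_of_mem ((hmem i t).1 hi), mul_comm]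

lemma exists_abs_sum_le_of_tendsto (hS : ∀ i u, i ∈ S u ↔ l i ≤ u) {L : ℝ}
    (h : Tendsto (fun u => ∑ i ∈ S u, a i) atTop (𝓝 L)) : ∃ K, ∀ u, |∑ i ∈ S u, a i| ≤ K := by
  obtain ⟨U, hU⟩ := eventually_atTop.1 (h.abs.eventually_le_const (lt_add_one |L|))
  refine ⟨max (|L| + 1) (∑ i ∈ S U, |a i|), fun u => ?_⟩
  rcases le_total U u with hu | hu
  · exact le_max_of_le_left (hU u hu)
  · refine le_max_of_le_right ((Finset.abs_sum_le_sum_abs _ _).trans ?_)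
    exact Finset.sum_le_sum_of_subset_of_nonneg (fun i hi => (hS i U).2 (((hS i u).1 hi).trans hu))
      fun i _ _ => abs_nonneg _

lemma tendsto_tsum_mul_exp_neg [Countable ι] (hl : ∀ i, 0 ≤ l i)
    (hS : ∀ i u, i ∈ S u ↔ l i ≤ u) (ha : ∀ s > 0, Summable fun i => a i * exp (-(s * l i)))
    {L : ℝ} (h : Tendsto (fun u => ∑ i ∈ S u, a i) atTop (𝓝 L)) :
    Tendsto (fun s => ∑' i, a i * exp (-(s * l i))) (𝓝[>] 0) (𝓝 L) := by
  obtain ⟨K, hK⟩ := exists_abs_sum_le_of_tendsto hS h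
  have hL : ∫ t in Set.Ioi (0 : ℝ), exp (-t) * L = L := by
    rw [integral_mul_const, integral_exp_neg_Ioi, neg_zero, exp_zero, one_mul]
  have hmeas : Measurable fun u => ∑ i ∈ S u, a i :=
    (measurable_from_top (f := fun T : Finset ι => ∑ i ∈ T, a i)).comp
      (measurable_finset_of_mem_iff_le hS)
  have hlim : Tendsto (fun s => ∫ t in Set.Ioi 0, exp (-t) * ∑ i ∈ S (t / s), a i) (𝓝[>] 0)
      (𝓝 (∫ t in Set.Ioi (0 : ℝ), exp (-t) * L)) := by
    refine tendsto_integral_filter_of_dominated_convergence (fun t => exp (-t) * K)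
      (.of_forall fun s => ?_) (.of_forall fun s => .of_forall fun t => ?_)
      ((integrableOn_exp_neg_Ioi 0).mul_const K) ?_
    · exact ((measurable_exp.comp measurable_neg).mul
        (hmeas.comp (measurable_id.div_const s))).aestronglyMeasurable
    · rw [norm_mul, norm_of_nonneg (exp_pos _).le]
      exact mul_le_mul_of_nonneg_left (hK _) (exp_pos _).le
    · filter_upwards [ae_restrict_mem measurableSet_Ioi] with t ht
      simp only [div_eq_mul_inv]
      exact (h.comp (tendsto_inv_nhdsGT_zero.const_mul_atTop ht)).const_mul _
  rw [hL] at hlim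
  refine hlim.congr' ?_
  filter_upwards [self_mem_nhdsWithin] with s hs
  exact (tsum_mul_exp_neg_eq_integral hl hS hs (ha s hs)).symm

end AbelSummation

section MertensConstant

open Finset Filter Topology Real

lemma tendsto_log_sub_log_of_isEquivalent {α : Type*} {F : Filter α} {f g : α → ℝ}
    (h : f ~[F] g) (hg : ∀ᶠ x in F, g x ≠ 0) :
    Tendsto (fun x => log (f x) - log (g x)) F (𝓝 0) := by
  have hratio := (Asymptotics.isEquivalent_iff_tendsto_one hg).1 h
  have hlog := (continuousAt_log one_ne_zero).tendsto.comp hratio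
  rw [log_one] at hlog
  refine hlog.congr' ?_
  filter_upwards [hg, hratio.eventually_ne one_ne_zero] with x hgx hx
  exact log_div (fun hf => hx (by simp [hf])) hgx

lemma tendsto_log_floor_sub_log :
    Tendsto (fun x : ℝ => log (⌊x⌋₊ : ℝ) - log x) atTop (𝓝 0) :=
  tendsto_log_sub_log_of_isEquivalent Asymptotics.isEquivalent_nat_floor
    (eventually_ne_atTop 0)

lemma tendsto_log_log_floor_sub_log_log :
    Tendsto (fun x : ℝ => log (log (⌊x⌋₊ : ℝ)) - log (log x)) atTop (𝓝 0) :=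
  tendsto_log_sub_log_of_isEquivalent
    (Asymptotics.isEquivalent_nat_floor.log tendsto_id)
    (tendsto_log_atTop.eventually_ne_atTop 0)

lemma tendsto_sum_one_div_primesLE_sub_harmonic {c : ℝ}
    (hc : Tendsto (fun n : ℕ => ∑ p ∈ Nat.primesLE n, 1 / (p : ℝ) - log (log n)) atTop (𝓝 c)) :
    Tendsto (fun u : ℝ => ∑ p ∈ Nat.primesLE ⌊exp u⌋₊, 1 / (p : ℝ) - harmonic ⌊u⌋₊) atTop
      (𝓝 (c - eulerMascheroniConstant)) := by
  have hprimes := hc.comp (tendsto_nat_floor_atTop.comp tendsto_exp_atTop)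
  have hharmonic := tendsto_harmonic_sub_log.comp (tendsto_nat_floor_atTop (α := ℝ))
  have hfloor := (tendsto_log_log_floor_sub_log_log.comp tendsto_exp_atTop).sub
    tendsto_log_floor_sub_log
  have h := (hprimes.sub hharmonic).add hfloor
  rw [sub_zero, add_zero] at h
  refine h.congr fun u => ?_
  simp only [Function.comp_apply, log_exp]
  ring

lemma hasSum_one_div_mul_exp_neg {s : ℝ} (hs : 0 < s) :
    HasSum (fun n : ℕ => 1 / ((n : ℝ) + 1) * exp (-(s * (n + 1)))) (-log (1 - exp (-s))) := by
  have h := hasSum_pow_div_log_of_abs_lt_one (x := exp (-s)) (by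
    rw [abs_of_pos (exp_pos _)]
    exact Real.exp_lt_one_iff.2 (by linarith))
  convert h using 2 with n
  rw [← exp_nat_mul, one_div_mul_eq_div]
  push_cast
  ring_nf

/-- The primes `p ≤ n` as elements of `Nat.Primes`, the index type of Euler products in Mathlib. -/
def primesFinset (n : ℕ) : Finset Nat.Primes := (Nat.primesLE n).subtype Nat.Prime

lemma mem_primesFinset {p : Nat.Primes} {n : ℕ} : p ∈ primesFinset n ↔ (p : ℕ) ≤ n :=
  mem_subtype.trans (Nat.mem_primesLE.trans (and_iff_left p.2))

lemma sum_primesFinset {M : Type*} [AddCommMonoid M] (f : ℕ → M) (n : ℕ) :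
    ∑ p ∈ primesFinset n, f p = ∑ p ∈ Nat.primesLE n, f p :=
  sum_subtype_of_mem f fun _ => Nat.prime_of_mem_primesLE

lemma tendsto_primesFinset_atTop : Tendsto primesFinset atTop atTop :=
  tendsto_atTop_finset_of_monotone
    (fun _ _ h _ hp => mem_primesFinset.2 ((mem_primesFinset.1 hp).trans h))
    fun p => ⟨p, mem_primesFinset.2 le_rfl⟩

lemma one_div_mul_exp_neg_mul_log {x : ℝ} (hx : 0 < x) (s : ℝ) :
    1 / x * exp (-(s * log x)) = x ^ (-(1 + s)) := by
  rw [neg_add, rpow_add hx, rpow_neg_one, rpow_def_of_pos hx, one_div, mul_neg, mul_comm s]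

lemma summable_primes_rpow_neg {x : ℝ} (hx : 1 < x) :
    Summable fun p : Nat.Primes => (p : ℝ) ^ (-x) :=
  (Real.summable_nat_rpow.2 (by linarith)).comp_injective Nat.Primes.coe_nat_injective

lemma tendsto_tsum_primes_rpow_add_log {c : ℝ}
    (hc : Tendsto (fun n : ℕ => ∑ p ∈ Nat.primesLE n, 1 / (p : ℝ) - log (log n)) atTop (𝓝 c)) :
    Tendsto (fun s : ℝ => ∑' p : Nat.Primes, (p : ℝ) ^ (-(1 + s)) + log (1 - exp (-s)))
      (𝓝[>] 0) (𝓝 (c - eulerMascheroniConstant)) := by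
  -- Each series alone diverges as `s → 0`; Abel's theorem applies only to the merged series.
  let a : Nat.Primes ⊕ ℕ → ℝ := Sum.elim (fun p => 1 / (p : ℝ)) fun n => -(1 / ((n : ℝ) + 1))
  let l : Nat.Primes ⊕ ℕ → ℝ := Sum.elim (fun p => log p) fun n => (n : ℝ) + 1
  have hl : ∀ i, 0 ≤ l i
    | .inl p => log_natCast_nonneg p
    | .inr n => add_nonneg n.cast_nonneg zero_le_one
  let S (u : ℝ) : Finset (Nat.Primes ⊕ ℕ) := (primesFinset ⌊exp u⌋₊).disjSum (range ⌊u⌋₊)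
  have hS : ∀ i u, i ∈ S u ↔ l i ≤ u
    | .inl p, u => inl_mem_disjSum.trans <| mem_primesFinset.trans <|
      (Nat.le_floor_iff (exp_pos u).le).trans
        (log_le_iff_le_exp (by exact_mod_cast p.2.pos)).symm
    | .inr n, u => inr_mem_disjSum.trans <| mem_range.trans <| Nat.succ_le_iff.symm.trans <|
      (Nat.le_floor_iff' n.succ_ne_zero).trans (by simp [l])
  have hsum {s : ℝ} (hs : 0 < s) : HasSum (fun i => a i * exp (-(s * l i)))
      (∑' p : Nat.Primes, (p : ℝ) ^ (-(1 + s)) + log (1 - exp (-s))) := by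
    refine .sum ?_ ?_
    · refine (summable_primes_rpow_neg (by linarith)).hasSum.congr_fun fun p => ?_
      exact one_div_mul_exp_neg_mul_log (by exact_mod_cast p.2.pos) s
    · simpa [Function.comp_def, a, l] using (hasSum_one_div_mul_exp_neg hs).neg
  have hpartial (u : ℝ) : ∑ i ∈ S u, a i =
      ∑ p ∈ Nat.primesLE ⌊exp u⌋₊, 1 / (p : ℝ) - harmonic ⌊u⌋₊ := by
    rw [← sum_primesFinset fun p => 1 / (p : ℝ), sum_disjSum]
    simp [harmonic, a, sub_eq_add_neg]
  refine (tendsto_tsum_mul_exp_neg hl hS (fun s hs => (hsum hs).summable)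
    ((tendsto_sum_one_div_primesLE_sub_harmonic hc).congr fun u => (hpartial u).symm)).congr' ?_
  filter_upwards [self_mem_nhdsWithin] with s hs using (hsum hs).tsum_eq

lemma tsum_primes_neg_log_one_sub_rpow {x : ℝ} (hx : 1 < x) :
    ∑' p : Nat.Primes, -log (1 - (p : ℝ) ^ (-x)) = log (∑' n : ℕ, 1 / (n : ℝ) ^ x) := by
  let f : ℕ →*₀ ℝ :=
    { toFun := fun n => (n : ℝ) ^ (-x)
      map_zero' := by rw [Nat.cast_zero, zero_rpow (by linarith)]
      map_one' := by rw [Nat.cast_one, one_rpow]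
      map_mul' := fun m n => by rw [Nat.cast_mul, mul_rpow m.cast_nonneg n.cast_nonneg] }
  have hprod := EulerProduct.eulerProduct_completely_multiplicative_hasProd (f := f)
    (Real.summable_nat_rpow.2 (by linarith)).norm
  have hpos (p : Nat.Primes) : 0 < 1 - f p :=
    sub_pos.2 (rpow_lt_one_of_one_lt_of_neg (by exact_mod_cast p.2.one_lt) (by linarith))
  have hsummable : Summable fun p : Nat.Primes => log (1 - f p)⁻¹ := by
    refine (Real.summable_log_one_add_of_summable (summable_primes_rpow_neg hx).neg).neg.congr
      fun p => ?_
    rw [log_inv, sub_eq_add_neg]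
    rfl
  have hexp := Real.rexp_tsum_eq_tprod (fun p => inv_pos.2 (hpos p)) hsummable
  rw [hprod.tprod_eq] at hexp
  calc ∑' p : Nat.Primes, -log (1 - (p : ℝ) ^ (-x)) = ∑' p : Nat.Primes, log (1 - f p)⁻¹ :=
        tsum_congr fun p => (log_inv _).symm
    _ = log (∑' n, f n) := by rw [← hexp, log_exp]
    _ = log (∑' n : ℕ, 1 / (n : ℝ) ^ x) := by
        congr 2 with n
        rw [one_div, ← rpow_neg n.cast_nonneg]
        rfl

lemma tendsto_log_mul_tsum_one_div_rpow :
    Tendsto (fun s : ℝ => log (s * ∑' n : ℕ, 1 / (n : ℝ) ^ (1 + s))) (𝓝[>] 0) (𝓝 0) := by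
  have hshift : Tendsto (fun s : ℝ => 1 + s) (𝓝[>] 0) (𝓝[>] 1) := by
    have : ContinuousAt (fun s : ℝ => 1 + s) 0 := by fun_prop
    refine tendsto_nhdsWithin_iff.2 ⟨by simpa using this.tendsto.mono_left nhdsWithin_le_nhds, ?_⟩
    filter_upwards [self_mem_nhdsWithin] with s hs using
      lt_add_of_pos_right 1 (Set.mem_Ioi.1 hs)
  have h := (continuousAt_log one_ne_zero).tendsto.comp
    (tendsto_sub_mul_tsum_nat_rpow.comp hshift)
  rw [log_one] at h
  refine h.congr fun s => ?_
  simp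

lemma tendsto_log_one_sub_exp_neg_div :
    Tendsto (fun s : ℝ => log ((1 - exp (-s)) / s)) (𝓝[>] 0) (𝓝 0) := by
  have hderiv : HasDerivAt (fun s : ℝ => 1 - exp (-s)) 1 0 := by
    simpa using ((hasDerivAt_id (0 : ℝ)).neg.exp).const_sub 1
  have hslope := (hasDerivAt_iff_tendsto_slope.1 hderiv).mono_left
    (nhdsWithin_mono 0 fun x (hx : 0 < x) => hx.ne')
  have h := (continuousAt_log one_ne_zero).tendsto.comp hslope
  rw [log_one] at h
  refine h.congr fun s => ?_
  simp [slope_def_field]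

lemma tendsto_tsum_primes_logTail_rpow :
    Tendsto (fun s : ℝ => ∑' p : Nat.Primes, logTail ((p : ℝ) ^ (-(1 + s)))) (𝓝[>] 0)
      (𝓝 (∑' p : Nat.Primes, logTail (1 / p))) := by
  refine tendsto_tsum_of_dominated_convergence
    (bound := fun p : Nat.Primes => 2 * (p : ℝ) ^ (-2 : ℝ))
    ((summable_primes_rpow_neg one_lt_two).mul_left 2) (fun p => ?_) ?_
  · have hp : (1 : ℝ) < p := by exact_mod_cast p.2.one_lt
    have hcont : ContinuousAt (fun s : ℝ => (p : ℝ) ^ (-(1 + s))) 0 :=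
      (continuousAt_const_rpow (by linarith)).comp (by fun_prop)
    have hlim : Tendsto (fun s : ℝ => (p : ℝ) ^ (-(1 + s))) (𝓝[>] 0) (𝓝 (1 / p)) := by
      simpa [rpow_neg_one] using hcont.tendsto.mono_left nhdsWithin_le_nhds
    exact (continuousAt_logTail ((div_lt_one (by linarith)).2 hp)).tendsto.comp hlim
  · filter_upwards [self_mem_nhdsWithin] with s hs p
    have hp : (2 : ℝ) ≤ p := by exact_mod_cast p.2.two_le
    have hle : (p : ℝ) ^ (-(1 + s)) ≤ (p : ℝ) ^ (-1 : ℝ) :=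
      rpow_le_rpow_of_exponent_le (by linarith) (by linarith [Set.mem_Ioi.1 hs])
    have hpos : 0 < (p : ℝ) ^ (-(1 + s)) := rpow_pos_of_pos (by linarith) _
    have hhalf : (p : ℝ) ^ (-1 : ℝ) ≤ 1 / 2 := by
      rw [rpow_neg_one, one_div]
      exact inv_anti₀ two_pos hp
    calc ‖logTail ((p : ℝ) ^ (-(1 + s)))‖ ≤ 2 * ((p : ℝ) ^ (-(1 + s))) ^ 2 :=
          abs_logTail_le (by rw [abs_of_pos hpos]; exact hle.trans hhalf)
      _ ≤ 2 * ((p : ℝ) ^ (-1 : ℝ)) ^ 2 := by gcongr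
      _ = 2 * (p : ℝ) ^ (-2 : ℝ) := by
          rw [← rpow_natCast, ← rpow_mul (by linarith)]
          norm_num

lemma tendsto_tsum_primes_rpow_add_log_one_sub_exp_neg :
    Tendsto (fun s : ℝ => ∑' p : Nat.Primes, (p : ℝ) ^ (-(1 + s)) + log (1 - exp (-s)))
      (𝓝[>] 0) (𝓝 (-∑' p : Nat.Primes, logTail (1 / p))) := by
  have h := (tendsto_log_mul_tsum_one_div_rpow.add tendsto_log_one_sub_exp_neg_div).sub
    tendsto_tsum_primes_logTail_rpow
  rw [add_zero, zero_sub] at h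
  refine h.congr' ?_
  filter_upwards [self_mem_nhdsWithin] with s hs
  have hs : 0 < s := hs
  have hx : 1 < 1 + s := by linarith
  have hzeta : 0 < ∑' n : ℕ, 1 / (n : ℝ) ^ (1 + s) :=
    (Real.summable_one_div_nat_rpow.2 hx).tsum_pos (fun n => by positivity) 1 (by simp)
  have hexp : 0 < 1 - exp (-s) := sub_pos.2 (Real.exp_lt_one_iff.2 (by linarith))
  have hsummable := summable_primes_rpow_neg hx
  have hlog : Summable fun p : Nat.Primes => -log (1 - (p : ℝ) ^ (-(1 + s))) :=
    (Real.summable_log_one_add_of_summable hsummable.neg).neg.congr fun p => by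
      rw [sub_eq_add_neg]
  simp only [logTail]
  rw [hlog.tsum_sub hsummable, tsum_primes_neg_log_one_sub_rpow hx, log_mul hs.ne' hzeta.ne',
    log_div hexp.ne' hs.ne']
  ring

lemma tendsto_sum_logTail_one_div_primesLE :
    Tendsto (fun n : ℕ => ∑ p ∈ Nat.primesLE n, logTail (1 / p)) atTop
      (𝓝 (∑' p : Nat.Primes, logTail (1 / p))) := by
  have hsummable : Summable fun p : Nat.Primes => logTail (1 / p) := by
    refine summable_logTail ((summable_primes_rpow_neg one_lt_two).congr fun p => ?_)
    rw [one_div, inv_pow, rpow_neg p.1.cast_nonneg]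
    norm_cast
  exact (hsummable.hasSum.comp tendsto_primesFinset_atTop).congr fun n =>
    sum_primesFinset (fun p => logTail (1 / p)) n

lemma tendsto_sum_neg_log_one_sub_one_div_primesLE_sub_log_log :
    Tendsto (fun n : ℕ => ∑ p ∈ Nat.primesLE n, -log (1 - 1 / (p : ℝ)) - log (log n)) atTop
      (𝓝 eulerMascheroniConstant) := by
  obtain ⟨c, hc⟩ := exists_tendsto_sum_one_div_primesLE_sub_log_log
  have hconst : c - eulerMascheroniConstant = -∑' p : Nat.Primes, logTail (1 / p) :=
    tendsto_nhds_unique (tendsto_tsum_primes_rpow_add_log hc)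
      tendsto_tsum_primes_rpow_add_log_one_sub_exp_neg
  have h := hc.add tendsto_sum_logTail_one_div_primesLE
  rw [show c + ∑' p : Nat.Primes, logTail (1 / p) = eulerMascheroniConstant by linarith] at h
  refine h.congr fun n => ?_
  simp only [logTail, sum_sub_distrib]
  ring

end MertensConstant

section PrimesIn

open Finset Filter Topology

lemma mem_primesIn {a p : ℕ} {z : ℝ} : p ∈ primesIn a z ↔ (a ≤ p ∧ p ≤ ⌊z⌋₊) ∧ p.Prime := by
  rw [primesIn, mem_filter, mem_Icc]

lemma primesIn_two (z : ℝ) : primesIn 2 z = Nat.primesLE ⌊z⌋₊ := by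
  rw [primesIn, Nat.primesLE_eq_filter_Icc_two]

lemma primeProd_eq_prod_primesIn (z : ℝ) : primeProd z = ∏ p ∈ primesIn 2 z, p := by
  rw [primeProd, primorial_eq_prod_primesLE, primesIn_two]

lemma prod_primesIn_eq_mul {M : Type*} [CommMonoid M] {a : ℕ} (ha : a.Prime) {z : ℝ}
    (haz : a ≤ z) (f : ℕ → M) :
    ∏ p ∈ primesIn a z, f p = f a * ∏ p ∈ primesIn (a + 1) z, f p := by
  have hmem : a ∉ primesIn (a + 1) z := by simp [mem_primesIn]
  rw [← prod_insert hmem, primesIn, primesIn,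
    ← insert_Icc_add_one_left_eq_Icc (Nat.le_floor haz), filter_insert, if_pos ha]

lemma primesIn_four (z : ℝ) : primesIn 4 z = primesIn 5 z := by
  ext p
  rw [mem_primesIn, mem_primesIn]
  refine and_congr_left fun hp => and_congr_left fun _ => ⟨fun h => h.lt_of_ne ?_, by lia⟩
  rintro rfl
  exact absurd hp (by decide)

lemma tendsto_prod_primesIn {a : ℕ} {f : ℕ → ℝ}
    (hf : Multipliable fun p : {p : ℕ // p.Prime ∧ a ≤ p} => f p) :
    Tendsto (fun z : ℝ => ∏ p ∈ primesIn a z, f p) atTop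
      (𝓝 (∏' p : {p : ℕ // p.Prime ∧ a ≤ p}, f p)) := by
  have hprod := hasProd_subtype_iff_mulIndicator (s := {p : ℕ | p.Prime ∧ a ≤ p}).1 hf.hasProd
  refine (hprod.tendsto_prod_nat.comp ((tendsto_add_atTop_nat 1).comp
    (tendsto_nat_floor_atTop (α := ℝ)))).congr fun z => ?_
  simp only [Function.comp_apply, Set.mulIndicator_apply, Set.mem_ofPred_eq]
  rw [← prod_filter]
  refine prod_congr (Finset.ext fun p => ?_) fun _ _ => rfl
  rw [mem_primesIn, mem_filter, mem_range, Nat.lt_succ_iff]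
  tauto

lemma filter_dvd_primesIn {N : ℕ} (hN : N ≠ 0) (a : ℕ) {z : ℝ} (hz : N ≤ z) :
    {p ∈ primesIn a z | p ∣ N} = {p ∈ N.primeFactors | a ≤ p} := by
  ext p
  rw [mem_filter, mem_filter, mem_primesIn, Nat.mem_primeFactors]
  constructor
  · rintro ⟨⟨⟨hap, -⟩, hp⟩, hpN⟩
    exact ⟨⟨hp, hpN, hN⟩, hap⟩
  · rintro ⟨⟨hp, hpN, -⟩, hap⟩
    have hpz : p ≤ ⌊z⌋₊ := (Nat.le_of_dvd (Nat.pos_of_ne_zero hN) hpN).trans (Nat.le_floor hz)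
    exact ⟨⟨⟨hap, hpz⟩, hp⟩, hpN⟩

lemma prod_primesIn_one_sub_one_div_isEquivalent :
    (fun z : ℝ => ∏ p ∈ primesIn 2 z, (1 - 1 / (p : ℝ))) ~[atTop]
      fun z => 1 / (C₁ * Real.log z) := by
  refine Asymptotics.isEquivalent_of_tendsto_one ?_
  have hlog := (tendsto_sum_neg_log_one_sub_one_div_primesLE_sub_log_log.comp
    (tendsto_nat_floor_atTop (α := ℝ))).add tendsto_log_log_floor_sub_log_log
  have h := (Real.continuous_exp.tendsto _).comp
    ((tendsto_const_nhds (x := Real.eulerMascheroniConstant)).sub hlog)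
  rw [add_zero, sub_self, Real.exp_zero] at h
  refine h.congr' ?_
  filter_upwards [eventually_gt_atTop 1] with z hz
  have hpos : ∀ p ∈ primesIn 2 z, 0 < 1 - 1 / (p : ℝ) := fun p hp => by
    have hp : (1 : ℝ) < p := by exact_mod_cast (mem_primesIn.1 hp).2.one_lt
    exact sub_pos.2 ((div_lt_one (by linarith)).2 hp)
  simp only [Function.comp_apply, Pi.div_apply]
  rw [sum_neg_distrib, ← primesIn_two, ← Real.log_prod fun p hp => (hpos p hp).ne', C₁, one_div,
    div_inv_eq_mul, sub_add_sub_cancel, ← sub_add, sub_neg_eq_add,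
    add_right_comm, Real.exp_add, Real.exp_add, Real.exp_log (Real.log_pos hz),
    Real.exp_log (prod_pos hpos)]
  ring

end PrimesIn

section Sieve

open Finset Function

lemma card_filter_Icc_natCast {n : ℕ} [NeZero n] (R : ZMod n → Prop) [DecidablePred R] :
    #{k ∈ Icc 1 n | R (k : ℕ)} = #{x : ZMod n | R x} := by
  have hperiodic : Periodic (fun k : ℕ => R k) n := fun k => by simp
  calc #{k ∈ Icc 1 n | R (k : ℕ)} = #{k ∈ range n | R (k : ℕ)} := by
        rw [← Ico_add_one_right_eq_Icc, add_comm n,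
          Nat.filter_Ico_card_eq_of_periodic 1 n _ hperiodic, Nat.count_eq_card_filter_range]
    _ = #{x : ZMod n | R x} := by
        refine card_nbij' (fun k : ℕ => (k : ZMod n)) ZMod.val ?_ ?_ ?_ ?_
        · simp +contextual [Set.MapsTo]
        · simp [Set.MapsTo, ZMod.val_lt]
        · simp +contextual [Set.LeftInvOn, Nat.mod_eq_of_lt]
        · simp [Set.LeftInvOn]

lemma card_filter_Icc_prod_natCast_notMem {ι : Type*} [Fintype ι] {a : ι → ℕ}
    [∀ i, NeZero (a i)] (hcoprime : Pairwise (Nat.Coprime on a)) (F : ∀ i, Finset (ZMod (a i))) :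
    #{n ∈ Icc 1 (∏ i, a i) | ∀ i, ((n : ℕ) : ZMod (a i)) ∉ F i} = ∏ i, (a i - #(F i)) := by
  classical
  have : NeZero (∏ i, a i) := ⟨prod_ne_zero_iff.2 fun i _ => NeZero.ne (a i)⟩
  let φ := ZMod.prodEquivPi a hcoprime
  calc #{n ∈ Icc 1 (∏ i, a i) | ∀ i, ((n : ℕ) : ZMod (a i)) ∉ F i} =
        #{n ∈ Icc 1 (∏ i, a i) | ∀ i, φ (n : ℕ) i ∉ F i} := by simp [φ]
    _ = #{x | ∀ i, φ x i ∉ F i} := card_filter_Icc_natCast fun x => ∀ i, φ x i ∉ F i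
    _ = #(Fintype.piFinset fun i => (F i)ᶜ) := card_equiv φ.toEquiv fun x => by simp
    _ = ∏ i, (a i - #(F i)) := by simp [Fintype.card_piFinset, card_compl]

lemma card_filter_Icc_primeProd_div (z : ℝ) (F : ∀ p, Finset (ZMod p)) :
    (#{n ∈ Icc 1 (primeProd z) | ∀ p ∈ primesIn 2 z, ((n : ℕ) : ZMod p) ∉ F p} : ℝ) /
      primeProd z = ∏ p ∈ primesIn 2 z, (1 - (#(F p) : ℝ) / p) := by
  have hprime (p : primesIn 2 z) : (p : ℕ).Prime := (mem_primesIn.1 p.2).2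
  have (p : primesIn 2 z) : NeZero (p : ℕ) := ⟨(hprime p).ne_zero⟩
  have hcoprime : Pairwise (Nat.Coprime on fun p : primesIn 2 z => (p : ℕ)) := fun p q hpq =>
    (Nat.coprime_primes (hprime p) (hprime q)).2 (Subtype.coe_injective.ne hpq)
  have hcard := card_filter_Icc_prod_natCast_notMem hcoprime fun p => F p
  simp only [Subtype.forall] at hcard
  rw [prod_coe_sort (primesIn 2 z) fun p => p,
    prod_coe_sort (primesIn 2 z) fun p => p - #(F p), ← primeProd_eq_prod_primesIn] at hcard
  rw [hcard, primeProd_eq_prod_primesIn, Nat.cast_prod, Nat.cast_prod, ← prod_div_distrib]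
  refine prod_congr rfl fun p hp => ?_
  have : NeZero p := ⟨(mem_primesIn.1 hp).2.ne_zero⟩
  have hle : #(F p) ≤ p := (card_le_univ _).trans_eq (ZMod.card p)
  rw [Nat.cast_sub hle, sub_div, div_self (NeZero.ne _)]

lemma cofactor_prod_primes {S : Finset ℕ} (hS : ∀ p ∈ S, p.Prime) (n : ℕ) :
    cofactor (∏ p ∈ S, p) n = ∏ p ∈ S with ¬ p ∣ n, p := by
  have hcoprime : Nat.Coprime (∏ p ∈ S with ¬ p ∣ n, p) n := Nat.coprime_prod_left_iff.2
    fun p hp => (hS p (mem_filter.1 hp).1).coprime_iff_not_dvd.2 (mem_filter.1 hp).2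
  have hdvd : ∏ p ∈ S with p ∣ n, p ∣ n := prod_primes_dvd n
    (fun p hp => (hS p (mem_filter.1 hp).1).prime) fun p hp => (mem_filter.1 hp).2
  have hpos : 0 < ∏ p ∈ S with p ∣ n, p := prod_pos fun p hp => (hS p (mem_filter.1 hp).1).pos
  rw [cofactor, ← prod_filter_mul_prod_filter_not S (· ∣ n), hcoprime.gcd_mul_right_cancel,
    Nat.gcd_eq_left hdvd, Nat.mul_div_cancel_left _ hpos]

/-- The residues modulo `p` of the integers `n` with `p ∣ (N - n)(N + n)`, for `p` prime. -/
def excludedResidues (N p : ℕ) : Finset (ZMod p) := {(N : ZMod p), -(N : ZMod p)}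

/-- The residues modulo `p` that membership in `Wd 1 P N` excludes, for a prime `p ∣ P`: the class
`0` joins those of `W P N` when `p` divides `P_{6N}`. -/
def excludedResiduesCoprime (N p : ℕ) : Finset (ZMod p) :=
  if p ∣ 6 * N then excludedResidues N p else insert 0 (excludedResidues N p)

lemma natCast_mem_excludedResidues {N p n : ℕ} (hp : p.Prime) :
    (n : ZMod p) ∈ excludedResidues N p ↔ (p : ℤ) ∣ ((N : ℤ) - n) * ((N : ℤ) + n) := by
  have := Fact.mk hp
  rw [← ZMod.intCast_zmod_eq_zero_iff_dvd, excludedResidues, mem_insert, mem_singleton]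
  push_cast
  rw [mul_eq_zero, sub_eq_zero, eq_comm (a := (N : ZMod p)), add_comm (N : ZMod p),
    add_eq_zero_iff_eq_neg]

lemma natCast_mem_excludedResiduesCoprime {N p n : ℕ} :
    (n : ZMod p) ∈ excludedResiduesCoprime N p ↔
      (n : ZMod p) ∈ excludedResidues N p ∨ ¬ p ∣ 6 * N ∧ p ∣ n := by
  rw [excludedResiduesCoprime]
  split_ifs with h
  · simp [h]
  · rw [mem_insert, ZMod.natCast_eq_zero_iff, or_comm]
    simp [h]

lemma W_primeProd (z : ℝ) (N : ℕ) : W (primeProd z) N =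
    {n ∈ Icc 1 (primeProd z) | ∀ p ∈ primesIn 2 z, ((n : ℕ) : ZMod p) ∉ excludedResidues N p} := by
  refine filter_congr fun n _ => ?_
  rw [Int.gcd, Int.natAbs_natCast, primeProd_eq_prod_primesIn, ← Nat.Coprime,
    Nat.coprime_prod_right_iff]
  refine forall₂_congr fun p hp => ?_
  have hp := (mem_primesIn.1 hp).2
  rw [Nat.coprime_comm, hp.coprime_iff_not_dvd, natCast_mem_excludedResidues hp, Int.natCast_dvd]

lemma Wd_one_primeProd (z : ℝ) (N : ℕ) : Wd 1 (primeProd z) N =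
    {n ∈ Icc 1 (primeProd z) |
      ∀ p ∈ primesIn 2 z, ((n : ℕ) : ZMod p) ∉ excludedResiduesCoprime N p} := by
  rw [Wd, W_primeProd, filter_filter]
  refine filter_congr fun n _ => ?_
  rw [← Nat.Coprime, primeProd_eq_prod_primesIn,
    cofactor_prod_primes fun p hp => (mem_primesIn.1 hp).2, Nat.coprime_prod_left_iff]
  simp only [mem_filter, and_imp, ← forall₂_and]
  refine forall₂_congr fun p hp => ?_
  rw [natCast_mem_excludedResiduesCoprime, (mem_primesIn.1 hp).2.coprime_iff_not_dvd, not_or,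
    not_and]

lemma omega_primeProd_eq_prod (z : ℝ) (N : ℕ) : omega (primeProd z) N =
    ∏ p ∈ primesIn 2 z, (1 - (#(excludedResidues N p) : ℝ) / p) := by
  rw [omega, W_primeProd, card_filter_Icc_primeProd_div]

lemma omegaD_one_primeProd_eq_prod (z : ℝ) (N : ℕ) : omegaD 1 (primeProd z) N =
    ∏ p ∈ primesIn 2 z, (1 - (#(excludedResiduesCoprime N p) : ℝ) / p) := by
  rw [omegaD, Wd_one_primeProd, card_filter_Icc_primeProd_div]

end Sieve

section LocalDensities

open Finset

lemma card_excludedResidues_two (N : ℕ) : #(excludedResidues N 2) = 1 := by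
  simp [excludedResidues, ZMod.neg_eq_self_mod_two]

lemma card_excludedResidues_of_dvd {N p : ℕ} (hN : p ∣ N) : #(excludedResidues N p) = 1 := by
  simp [excludedResidues, (ZMod.natCast_eq_zero_iff N p).2 hN]

lemma card_excludedResidues_of_not_dvd {N p : ℕ} (hp : p.Prime) (h3 : 3 ≤ p) (hN : ¬ p ∣ N) :
    #(excludedResidues N p) = 2 := by
  refine card_pair fun h => ?_
  have hdvd : p ∣ 2 * N := by
    rw [← ZMod.natCast_eq_zero_iff]
    push_cast
    linear_combination h
  exact (hp.dvd_mul.1 hdvd).elim (fun h2 => absurd (Nat.le_of_dvd two_pos h2) (by lia)) hN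

lemma excludedResiduesCoprime_of_dvd {N p : ℕ} (h : p ∣ 6 * N) :
    excludedResiduesCoprime N p = excludedResidues N p := if_pos h

lemma card_excludedResiduesCoprime_of_not_dvd {N p : ℕ} (hp : p.Prime) (h5 : 5 ≤ p)
    (hN : ¬ p ∣ N) : #(excludedResiduesCoprime N p) = 3 := by
  have h6 : ¬ p ∣ 6 * N := fun h => by
    rcases hp.dvd_mul.1 h with h6 | h
    · rcases (hp.dvd_mul (m := 2) (n := 3)).1 h6 with h | h <;>
        exact absurd (Nat.le_of_dvd (by norm_num) h) (by lia)
    · exact hN h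
  have hzero : (0 : ZMod p) ∉ excludedResidues N p := by
    have hN0 : (N : ZMod p) ≠ 0 := mt (ZMod.natCast_eq_zero_iff N p).1 hN
    simp [excludedResidues, hN0, hN0.symm]
  rw [excludedResiduesCoprime, if_neg h6, card_insert_of_notMem hzero,
    card_excludedResidues_of_not_dvd hp (by lia) hN]

lemma one_sub_card_excludedResidues_div {N p : ℕ} (hp : p.Prime) (h3 : 3 ≤ p) :
    1 - (#(excludedResidues N p) : ℝ) / p =
      factor2 p * (if p ∣ N then ((p : ℝ) - 1) / (p - 2) else 1) * (1 - 1 / (p : ℝ)) ^ 2 := by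
  have h3' : (3 : ℝ) ≤ p := by exact_mod_cast h3
  have hp0 : (p : ℝ) ≠ 0 := by linarith
  have hp1 : (p : ℝ) - 1 ≠ 0 := by linarith
  have hp2 : (p : ℝ) - 2 ≠ 0 := by linarith
  rw [factor2]
  split_ifs with hN
  · rw [card_excludedResidues_of_dvd hN]
    field_simp
    norm_num
  · rw [card_excludedResidues_of_not_dvd hp h3 hN]
    field_simp
    norm_num

lemma one_sub_card_excludedResiduesCoprime_div {N p : ℕ} (hp : p.Prime) (h5 : 5 ≤ p) :
    1 - (#(excludedResiduesCoprime N p) : ℝ) / p =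
      factor3 p * (if p ∣ N then ((p : ℝ) - 1) / (p - 3) else 1) * (1 - 1 / (p : ℝ)) ^ 3 := by
  have h5' : (5 : ℝ) ≤ p := by exact_mod_cast h5
  have hp0 : (p : ℝ) ≠ 0 := by linarith
  have hp1 : (p : ℝ) - 1 ≠ 0 := by linarith
  have hp3 : (p : ℝ) - 3 ≠ 0 := by linarith
  rw [factor3]
  split_ifs with hN
  · rw [excludedResiduesCoprime_of_dvd (hN.mul_left 6), card_excludedResidues_of_dvd hN]
    field_simp
    norm_num
  · rw [card_excludedResiduesCoprime_of_not_dvd hp h5 hN]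
    field_simp
    norm_num

lemma one_sub_card_excludedResiduesCoprime_two (N : ℕ) :
    1 - (#(excludedResiduesCoprime N 2) : ℝ) / (2 : ℕ) = 1 / 2 := by
  rw [excludedResiduesCoprime_of_dvd (dvd_mul_of_dvd_left (by norm_num) N),
    card_excludedResidues_two]
  norm_num

lemma one_sub_card_excludedResiduesCoprime_three (N : ℕ) :
    1 - (#(excludedResiduesCoprime N 3) : ℝ) / (3 : ℕ) = threeFactor N / 3 := by
  rw [excludedResiduesCoprime_of_dvd (dvd_mul_of_dvd_left (by norm_num) N), threeFactor]
  split_ifs with hN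
  · rw [card_excludedResidues_of_dvd hN]
    norm_num
  · rw [card_excludedResidues_of_not_dvd Nat.prime_three le_rfl hN]
    norm_num

lemma omega_primeProd_eq (N : ℕ) {z : ℝ} (hz : 2 ≤ z) :
    omega (primeProd z) N =
      2 * (∏ p ∈ primesIn 3 z, factor2 p) *
        (∏ p ∈ (primesIn 3 z).filter (fun p => p ∣ N), ((p : ℝ) - 1) / ((p : ℝ) - 2)) *
        ∏ p ∈ primesIn 2 z, (1 - 1 / (p : ℝ)) ^ 2 := by
  have hlocal := prod_congr (s₁ := primesIn 3 z) rfl fun p hp =>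
    one_sub_card_excludedResidues_div (N := N) (mem_primesIn.1 hp).2 (mem_primesIn.1 hp).1.1
  rw [omega_primeProd_eq_prod, prod_primesIn_eq_mul Nat.prime_two hz,
    prod_primesIn_eq_mul Nat.prime_two hz, hlocal, prod_mul_distrib, prod_mul_distrib,
    card_excludedResidues_two, prod_filter]
  push_cast
  ring

lemma omegaD_one_primeProd_eq (N : ℕ) {z : ℝ} (hz : 3 ≤ z) :
    omegaD 1 (primeProd z) N =
      9 / 2 * (∏ p ∈ primesIn 5 z, factor3 p) * threeFactor N *
        (∏ p ∈ (primesIn 5 z).filter (fun p => p ∣ N), ((p : ℝ) - 1) / ((p : ℝ) - 3)) *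
        ∏ p ∈ primesIn 2 z, (1 - 1 / (p : ℝ)) ^ 3 := by
  have hlocal := prod_congr (s₁ := primesIn 5 z) rfl fun p hp =>
    one_sub_card_excludedResiduesCoprime_div (N := N) (mem_primesIn.1 hp).2
      (mem_primesIn.1 hp).1.1
  have hsplit (f : ℕ → ℝ) : ∏ p ∈ primesIn 2 z, f p = f 2 * (f 3 * ∏ p ∈ primesIn 5 z, f p) := by
    rw [prod_primesIn_eq_mul Nat.prime_two (by exact_mod_cast (by linarith : (2 : ℝ) ≤ z)),
      prod_primesIn_eq_mul Nat.prime_three hz, primesIn_four]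
  rw [omegaD_one_primeProd_eq_prod, hsplit, hsplit, hlocal, prod_mul_distrib, prod_mul_distrib,
    one_sub_card_excludedResiduesCoprime_two, one_sub_card_excludedResiduesCoprime_three,
    prod_filter]
  push_cast
  ring

end LocalDensities

section Asymptotics

open Finset Filter Topology Asymptotics

lemma multipliable_and_tprod_pos {ι : Type*} {f : ι → ℝ} (hpos : ∀ i, 0 < f i)
    (hf : Summable fun i => f i - 1) : Multipliable f ∧ 0 < ∏' i, f i := by
  have hlog := Real.summable_log_one_add_of_summable hf
  simp only [add_sub_cancel] at hlog
  exact ⟨Real.multipliable_of_summable_log hpos hlog,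
    Real.rexp_tsum_eq_tprod hpos hlog ▸ Real.exp_pos _⟩

lemma summable_subtype_of_abs_le_div_sq {P : ℕ → Prop} {g : ℕ → ℝ} {K : ℝ}
    (hg : ∀ n, P n → |g n| ≤ K / (n : ℝ) ^ 2) : Summable fun n : {n : ℕ // P n} => g n := by
  have hK : Summable fun n : ℕ => K / (n : ℝ) ^ 2 :=
    ((Real.summable_one_div_nat_pow.2 one_lt_two).mul_left K).congr fun n => mul_one_div _ _
  exact (hK.comp_injective Subtype.val_injective).of_norm_bounded fun n => hg n n.2

lemma abs_factor2_sub_one_le {p : ℕ} (hp : 3 ≤ p) : |factor2 p - 1| ≤ 4 / (p : ℝ) ^ 2 := by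
  have hp : (3 : ℝ) ≤ p := by exact_mod_cast hp
  have hp1 : 0 < (p : ℝ) - 1 := by linarith
  have heq : factor2 p - 1 = -(1 / ((p : ℝ) - 1) ^ 2) := by
    rw [factor2]
    field_simp
    ring
  rw [heq, abs_neg, abs_of_pos (by positivity), div_le_div_iff₀ (by positivity) (by positivity)]
  nlinarith

lemma abs_factor3_sub_one_le {p : ℕ} (hp : 5 ≤ p) : |factor3 p - 1| ≤ 16 / (p : ℝ) ^ 2 := by
  have hp : (5 : ℝ) ≤ p := by exact_mod_cast hp
  have hp1 : 0 < (p : ℝ) - 1 := by linarith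
  have heq : factor3 p - 1 = -((3 * p - 1) / ((p : ℝ) - 1) ^ 3) := by
    rw [factor3]
    field_simp
    ring
  rw [heq, abs_neg, abs_of_pos (div_pos (by linarith) (by positivity))]
  calc (3 * p - 1) / ((p : ℝ) - 1) ^ 3 ≤ 4 * (p - 1) / ((p : ℝ) - 1) ^ 3 := by
        gcongr
        linarith
    _ = 4 / ((p : ℝ) - 1) ^ 2 := by field_simp
    _ ≤ 16 / (p : ℝ) ^ 2 := by
        rw [div_le_div_iff₀ (by positivity) (by positivity)]
        nlinarith

lemma factor2_pos {p : ℕ} (hp : 3 ≤ p) : 0 < factor2 p := by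
  have hp : (3 : ℝ) ≤ p := by exact_mod_cast hp
  exact div_pos (mul_pos (by linarith) (by linarith)) (pow_pos (by linarith) 2)

lemma factor3_pos {p : ℕ} (hp : 5 ≤ p) : 0 < factor3 p := by
  have hp : (5 : ℝ) ≤ p := by exact_mod_cast hp
  exact div_pos (mul_pos (by linarith) (by positivity)) (pow_pos (by linarith) 3)

lemma multipliable_factor2_and_C₂_pos :
    Multipliable (fun p : {p : ℕ // p.Prime ∧ 3 ≤ p} => factor2 p) ∧ 0 < C₂ :=
  multipliable_and_tprod_pos (fun p => factor2_pos p.2.2) <|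
    summable_subtype_of_abs_le_div_sq (g := fun p => factor2 p - 1) fun _ hp =>
      abs_factor2_sub_one_le hp.2

lemma multipliable_factor3_and_C₃_pos :
    Multipliable (fun p : {p : ℕ // p.Prime ∧ 5 ≤ p} => factor3 p) ∧ 0 < C₃ :=
  multipliable_and_tprod_pos (fun p => factor3_pos p.2.2) <|
    summable_subtype_of_abs_le_div_sq (g := fun p => factor3 p - 1) fun _ hp =>
      abs_factor3_sub_one_le hp.2

lemma prod_primesIn_mul_prod_one_sub_one_div_pow_isEquivalent {a : ℕ} {f : ℕ → ℝ}
    (hf : Multipliable fun p : {p : ℕ // p.Prime ∧ a ≤ p} => f p)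
    (hne : ∏' p : {p : ℕ // p.Prime ∧ a ≤ p}, f p ≠ 0) (c : ℝ) (k : ℕ) :
    (fun z : ℝ => c * (∏ p ∈ primesIn a z, f p) * ∏ p ∈ primesIn 2 z, (1 - 1 / (p : ℝ)) ^ k)
      ~[atTop] fun z : ℝ => c * (∏' p : {p : ℕ // p.Prime ∧ a ≤ p}, f p) /
        (C₁ ^ k * Real.log z ^ k) := by
  have hprod := (isEquivalent_const_iff_tendsto hne).2 (tendsto_prod_primesIn hf)
  refine (((IsEquivalent.refl (u := fun _ => c)).mul hprod).mul
    (prod_primesIn_one_sub_one_div_isEquivalent.pow k)).congr_left ?_ |>.congr_right ?_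
  · exact .of_forall fun z => by simp [prod_pow]
  · exact .of_forall fun z => by simp [mul_pow, div_eq_mul_inv]

lemma omega_primeProd_isEquivalent {N : ℕ} (hN : N ≠ 0) :
    (fun z : ℝ => omega (primeProd z) N) ~[atTop]
      fun z : ℝ => 2 * C₂ * dN N / (C₁ ^ 2 * Real.log z ^ 2) := by
  obtain ⟨hmul, hpos⟩ := multipliable_factor2_and_C₂_pos
  refine ((prod_primesIn_mul_prod_one_sub_one_div_pow_isEquivalent hmul hpos.ne' (2 * dN N) 2
    ).congr_left ?_).congr_right (.of_forall fun z => ?_)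
  · filter_upwards [eventually_ge_atTop 2, eventually_ge_atTop (N : ℝ)] with z hz hNz
    rw [omega_primeProd_eq N hz, filter_dvd_primesIn hN 3 hNz, dN]
    ring
  · rw [← C₂]
    ring

lemma omegaD_one_primeProd_isEquivalent {N : ℕ} (hN : N ≠ 0) :
    (fun z : ℝ => omegaD 1 (primeProd z) N) ~[atTop]
      fun z : ℝ => 9 * C₃ * dN' N / (2 * C₁ ^ 3 * Real.log z ^ 3) := by
  obtain ⟨hmul, hpos⟩ := multipliable_factor3_and_C₃_pos
  refine ((prod_primesIn_mul_prod_one_sub_one_div_pow_isEquivalent hmul hpos.ne' (9 / 2 * dN' N) 3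
    ).congr_left ?_).congr_right (.of_forall fun z => ?_)
  · filter_upwards [eventually_ge_atTop 3, eventually_ge_atTop (N : ℝ)] with z hz hNz
    rw [omegaD_one_primeProd_eq N hz, filter_dvd_primesIn hN 5 hNz, dN']
    ring
  · rw [← C₃]
    ring

end Asymptotics

end GoldbachDensity

theorem mainTheorem12 :
    -- the infinite products defining `C₂` and `C₃` converge, to positive limits
    (Multipliable (fun p : {p : ℕ // p.Prime ∧ 3 ≤ p} => GoldbachDensity.factor2 p) ∧
      0 < GoldbachDensity.C₂) ∧
    (Multipliable (fun p : {p : ℕ // p.Prime ∧ 5 ≤ p} => GoldbachDensity.factor3 p) ∧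
      0 < GoldbachDensity.C₃) ∧
    ∀ N : ℕ, 1 ≤ N →
      -- exact formula and asymptotic formula for `ω_P(N)`
      (∀ z : ℝ, 2 ≤ z →
        GoldbachDensity.omega (GoldbachDensity.primeProd z) N =
          2 * (∏ p ∈ GoldbachDensity.primesIn 3 z,
                ((p : ℝ) - 2) * p / ((p : ℝ) - 1) ^ 2) *
            (∏ p ∈ (GoldbachDensity.primesIn 3 z).filter (fun p => p ∣ N),
                ((p : ℝ) - 1) / ((p : ℝ) - 2)) *
            ∏ p ∈ GoldbachDensity.primesIn 2 z, (1 - 1 / (p : ℝ)) ^ 2) ∧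
      ((fun z : ℝ => GoldbachDensity.omega (GoldbachDensity.primeProd z) N) ~[Filter.atTop]
        fun z : ℝ => 2 * GoldbachDensity.C₂ * GoldbachDensity.dN N /
          (GoldbachDensity.C₁ ^ 2 * Real.log z ^ 2)) ∧
      -- exact formula and asymptotic formula for `ω_P^1(N)`
      (∀ z : ℝ, 3 ≤ z →
        GoldbachDensity.omegaD 1 (GoldbachDensity.primeProd z) N =
          9 / 2 * (∏ p ∈ GoldbachDensity.primesIn 5 z,
                ((p : ℝ) - 3) * (p : ℝ) ^ 2 / ((p : ℝ) - 1) ^ 3) *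
            GoldbachDensity.threeFactor N *
            (∏ p ∈ (GoldbachDensity.primesIn 5 z).filter (fun p => p ∣ N),
                ((p : ℝ) - 1) / ((p : ℝ) - 3)) *
            ∏ p ∈ GoldbachDensity.primesIn 2 z, (1 - 1 / (p : ℝ)) ^ 3) ∧
      ((fun z : ℝ => GoldbachDensity.omegaD 1 (GoldbachDensity.primeProd z) N) ~[Filter.atTop]
        fun z : ℝ => 9 * GoldbachDensity.C₃ * GoldbachDensity.dN' N /
          (2 * GoldbachDensity.C₁ ^ 3 * Real.log z ^ 3)) := by
  open GoldbachDensity in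
  exact ⟨multipliable_factor2_and_C₂_pos, multipliable_factor3_and_C₃_pos, fun N hN =>
    have hN0 : N ≠ 0 := Nat.one_le_iff_ne_zero.1 hN
    ⟨fun _ hz => omega_primeProd_eq N hz, omega_primeProd_isEquivalent hN0,
      fun _ hz => omegaD_one_primeProd_eq N hz, omegaD_one_primeProd_isEquivalent hN0⟩⟩
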